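/- Let $m \ge 1$ and let $H_m < H_{m+1} < H_{m+2} < \cdots$ be a strictly increasing sequence of positive integers whose greatest common divisor is $1$. Put $$t(x) = \sum_{i=m}^{\infty} x^{H_i}.$$ For $n \ge 0$ let $c(n)$ be the number of compositions of $n$ (finite ordered sums of positive integers equal to $n$) all of whose summands belong to $\{H_m, H_{m+1}, \dots\}$, and, when $c(n) > 0$, let $\bar c(n)$ be the mean number of summands of such a composition chosen uniformly at random. Then there is exactly one positive real number $\gamma$ for which the series $t(\gamma)$ converges to $1$; it lies in $(0,1)$, $t$ is differentiable at $\gamma$ with $t'(\gamma) > 0$, and, as $n \to \infty$, $$c(n) \sim \frac{1}{t'(\gamma)}\,\gamma^{-n-1}, \qquad \bar c(n) \sim \frac{n}{\gamma\, t'(\gamma)}.$$ (In particular $c(n) > 0$ for all large $n$.) -/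

import Mathlib

open Filter Asymptotics

/-- The power series `t_{H,m}(x) = ∑_{i ≥ m} x ^ (H i)`, as a real function. -/
noncomputable def partSeries (H : ℕ → ℕ) (m : ℕ) (x : ℝ) : ℝ :=
  ∑' i : ℕ, x ^ H (m + i)

open Classical in
/-- The compositions of `n` (ordered sums of positive integers) all of whose summands belong to
`{H m, H (m + 1), …}`. -/
noncomputable def allowedCompositions (H : ℕ → ℕ) (m n : ℕ) : Finset (Composition n) :=
  Finset.univ.filter fun c => ∀ b ∈ c.blocks, ∃ i, m ≤ i ∧ H i = b

/-- The mean number of summands of a uniformly random composition of `n` with summands in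
`{H m, H (m + 1), …}` (with value `0` if there is no such composition). -/
noncomputable def meanSummands (H : ℕ → ℕ) (m n : ℕ) : ℝ :=
  (∑ c ∈ allowedCompositions H m n, (c.length : ℝ)) / ((allowedCompositions H m n).card : ℝ)

/-! Since `t(γ) = 1`, the weights `p k = γ ^ k` on allowed parts form a probability distribution
with mean `μ = γ t'(γ)`. Splitting off the first summand makes `u n = c(n) γ ^ n` a renewal
sequence, `U = 1 + P U`, and gcd 1 makes it aperiodic, so `tendsto_renewal` gives `u n → 1 / μ`. The
total number of summands, weighted by `γ ^ n`, has generating function `U² - U`, so divided by `n`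
it tends to `1 / μ²` (`tendsto_convolution_div`); dividing by `u n` gives the mean.

The renewal theorem rests on the conserved quantity `∑ r k * u (n - k) = 1`, where the tails `r` of
`p` sum to `μ`. Along an ultrafilter realizing the limsup `a`, a maximum principle forces all far
enough backward shifts of `u` to tend to `a` too, so `a μ = 1`. The same argument for `-u` handles
the liminf. -/

open Topology

/-! ### Discrete renewal theorem -/

/-- The tails of a summable nonnegative sequence sum to its mean. -/
theorem hasSum_tail_of_hasSum_mul {p : ℕ → ℝ} {μ : ℝ} (hp : ∀ k, 0 ≤ p k)
    (hsum : HasSum p 1) (hmean : HasSum (fun k : ℕ => k * p k) μ) :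
    HasSum (fun j => 1 - ∑ k ∈ Finset.range (j + 1), p k) μ := by
  -- Tonelli for the array `p n` on `j < n`: row sums are `n * p n`, column sums are the tails.
  have hrow (n : ℕ) : HasSum (fun j => if j < n then p n else 0) (n * p n) := by
    have h := hasSum_sum_of_ne_finset_zero (L := .unconditional ℕ) (f := fun j => if j < n then p n else 0)
      (s := Finset.range n) (by intro b hb; simp at hb; simp [hb])
    convert h using 1
    rw [Finset.sum_congr rfl (g := fun _ => p n)]
    · simp
    · intro j hj
      simp [Finset.mem_range.mp hj]
  have hf : Summable (fun q : ℕ × ℕ => if q.2 < q.1 then p q.1 else 0) := by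
    rw [summable_prod_of_nonneg]
    · refine ⟨fun n => (hrow n).summable, ?_⟩
      simpa only [(hrow _).tsum_eq] using hmean.summable
    · intro q
      dsimp only [Pi.zero_apply]
      split_ifs
      exacts [hp _, le_rfl]
  have hcol (j : ℕ) : HasSum (fun n => if j < n then p n else 0)
      (1 - ∑ k ∈ Finset.range (j + 1), p k) := by
    have h := hasSum_sum_of_ne_finset_zero (L := .unconditional ℕ) (f := fun n => if n < j + 1 then p n else 0)
      (s := Finset.range (j + 1)) (by intro b hb; simp at hb; simp; omega)
    rw [Finset.sum_congr rfl (g := p)] at h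
    · have he : (fun n => if j < n then p n else 0) =
          fun n => p n - if n < j + 1 then p n else 0 := by
        funext n
        by_cases hn : j < n
        · simp [hn, show ¬ n < j + 1 by omega]
        · simp [hn, show n < j + 1 by omega]
      rw [he]
      exact hsum.sub h
    · intro j hj
      simp [Finset.mem_range.mp hj]
  have h1 := hf.hasSum.prod_fiberwise hrow
  have hf' := (Equiv.prodComm ℕ ℕ).summable_iff.mpr hf
  have h2 := hf'.hasSum.prod_fiberwise hcol
  rwa [Function.comp_def, (Equiv.prodComm ℕ ℕ).tsum_eq (fun q : ℕ × ℕ => if q.2 < q.1 then p q.1 else 0),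
    h1.unique hmean] at h2

/-- A harmonic function for a renewal process attains its upper limit, along an ultrafilter, with
the value forced by the conserved quantity. -/
theorem renewal_limit_mul_mean {p r : ℕ → ℝ} {μ c a : ℝ} {x : ℤ → ℝ} {F : Ultrafilter ℤ}
    (hp : ∀ k, 0 ≤ p k) (hsum : HasSum p 1) (hr : ∀ k, 0 ≤ r k) (hrsum : HasSum r μ)
    (hper : ∃ k₀, ∀ n ≥ k₀, n ∈ AddSubmonoid.closure {k | p k ≠ 0})
    (hbdd : ∀ z, |x z| ≤ 1)
    (hrec : ∀ z, 1 ≤ z → HasSum (fun k : ℕ => p k * x (z - k)) (x z))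
    (hcons : ∀ z, 0 ≤ z → HasSum (fun k : ℕ => r k * x (z - k)) c)
    (hF : (F : Filter ℤ) ≤ atTop) (hlim : Tendsto x F (𝓝 a))
    (hsup : ∀ ε > 0, ∀ᶠ z in atTop, x z < a + ε) : a * μ = c := by
  have hshift (k : ℕ) : Tendsto (fun z : ℤ => z - k) F atTop :=
    (tendsto_atTop_add_const_right atTop (-(k : ℤ)) tendsto_id).mono_left hF
  -- By compactness an ultrafilter gives every shift a limit at once, replacing a diagonal
  -- subsequence.
  have hw (k : ℕ) : ∃ w, Tendsto (fun z : ℤ => x (z - k)) F (𝓝 w) := by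
    have hc : IsCompact (Set.Icc (-1 : ℝ) 1) := isCompact_Icc
    obtain ⟨w, -, h⟩ := hc.ultrafilter_le_nhds (F.map (fun z : ℤ => x (z - k)))
      (tendsto_principal.mpr (Eventually.of_forall fun z => abs_le.mp (hbdd _)))
    exact ⟨w, h⟩
  choose w hw using hw
  have hwle (k : ℕ) : w k ≤ a := by
    refine le_of_forall_pos_le_add fun ε hε => ?_
    exact le_of_tendsto (hw k) (((hshift k).eventually (hsup ε hε)).mono fun z hz => hz.le)
  have hwabs (k : ℕ) : |w k| ≤ 1 :=
    le_of_tendsto (hw k).abs (Eventually.of_forall fun z => hbdd _)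
  have hw0 : w 0 = a := tendsto_nhds_unique (hw 0) (by simpa using hlim)
  have hconv (q : ℕ → ℝ) (hq : ∀ k, 0 ≤ q k) (hqs : Summable q) (k : ℕ) :
      Tendsto (fun z : ℤ => ∑' j : ℕ, q j * x (z - k - j)) F (𝓝 (∑' j, q j * w (k + j))) := by
    refine tendsto_tsum_of_dominated_convergence hqs (fun j => ?_)
      (Eventually.of_forall fun z j => ?_)
    · refine Tendsto.const_mul _ ?_
      simpa [sub_sub] using hw (k + j)
    · rw [norm_mul, Real.norm_of_nonneg (hq j)]
      exact mul_le_of_le_one_right (hq j) (hbdd _)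
  have hwrec (k : ℕ) : w k = ∑' j, p j * w (k + j) := by
    refine tendsto_nhds_unique (hw k) ((hconv p hp hsum.summable k).congr' ?_)
    filter_upwards [(hshift k).eventually (eventually_ge_atTop 1)] with z hz
    exact (hrec _ hz).tsum_eq
  -- Maximum principle: `w k` is a `p`-average of values at most `a`, so equality forces `a`
  -- wherever `p` has mass.
  have hstep (k : ℕ) (hk : w k = a) (j : ℕ) (hj : p j ≠ 0) : w (k + j) = a := by
    by_contra hne
    have hlt : w (k + j) < a := lt_of_le_of_ne (hwle _) hne
    have hs : Summable (fun j => p j * w (k + j)) := by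
      refine Summable.of_norm_bounded hsum.summable fun i => ?_
      rw [norm_mul, Real.norm_of_nonneg (hp i)]
      exact mul_le_of_le_one_right (hp i) (hwabs _)
    have := hs.tsum_lt_tsum (g := fun i => p i * a) (i := j)
      (fun i => mul_le_mul_of_nonneg_left (hwle _) (hp i))
      (mul_lt_mul_of_pos_left hlt (lt_of_le_of_ne (hp j) hj.symm))
      (hsum.summable.mul_right a)
    rw [← hwrec, hk, tsum_mul_right, hsum.tsum_eq, one_mul] at this
    exact lt_irrefl _ this
  have hclos (n : ℕ) (hn : n ∈ AddSubmonoid.closure {k | p k ≠ 0}) : w n = a := by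
    induction hn using AddSubmonoid.closure_induction_right with
    | zero => exact hw0
    | add_right n _ j hj ih => exact hstep n ih j hj
  obtain ⟨k₀, hk₀⟩ := hper
  -- Shifting the conservation law by `k₀` involves only limits `w n` with `n ≥ k₀`, all equal to
  -- `a`.
  have h1 := hconv r hr hrsum.summable k₀
  have h2 : ∑' j, r j * w (k₀ + j) = a * μ := by
    rw [tsum_congr fun j => by rw [hclos _ (hk₀ (k₀ + j) (by omega))], tsum_mul_right,
      hrsum.tsum_eq, mul_comm]
  rw [h2] at h1
  refine tendsto_nhds_unique h1 (tendsto_const_nhds.congr' ?_)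
  filter_upwards [(hshift k₀).eventually (eventually_ge_atTop 0)] with z hz
  exact (hcons _ hz).tsum_eq.symm

/-- A bounded sequence has an upper limit that is attained along an ultrafilter. -/
theorem exists_ultrafilter_tendsto_limsup {x : ℤ → ℝ} (hbdd : ∀ z, |x z| ≤ 1) :
    ∃ (a : ℝ) (F : Ultrafilter ℤ), (F : Filter ℤ) ≤ atTop ∧ Tendsto x F (𝓝 a) ∧
      ∀ ε > 0, ∀ᶠ z in atTop, x z < a + ε := by
  have hle : IsBoundedUnder (· ≤ ·) atTop x :=
    isBoundedUnder_of ⟨1, fun z => (abs_le.mp (hbdd z)).2⟩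
  have hge : IsBoundedUnder (· ≥ ·) atTop x :=
    isBoundedUnder_of ⟨-1, fun z => (abs_le.mp (hbdd z)).1⟩
  have hup (ε : ℝ) (hε : 0 < ε) : ∀ᶠ z in atTop, x z < limsup x atTop + ε :=
    eventually_lt_of_limsup_lt (lt_add_of_pos_right _ hε) hle
  have hcl : MapClusterPt (limsup x atTop) atTop x := by
    rw [Metric.nhds_basis_ball.mapClusterPt_iff_frequently]
    intro ε hε
    have h := frequently_lt_of_lt_limsup hge.isCoboundedUnder_le
      (sub_lt_self (limsup x atTop) hε)
    refine (h.and_eventually (hup ε hε)).mono fun z hz => ?_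
    rw [Real.ball_eq_Ioo]
    exact ⟨hz.1, hz.2⟩
  obtain ⟨F, hF, hF'⟩ := mapClusterPt_iff_ultrafilter.mp hcl
  exact ⟨_, F, hF, hF', hup⟩

/-- The discrete renewal theorem for a waiting time distribution with finite mean. -/
theorem tendsto_renewal {p u : ℕ → ℝ} {μ : ℝ} (hp : ∀ k, 0 ≤ p k) (hp0 : p 0 = 0)
    (hsum : HasSum p 1) (hmean : HasSum (fun k : ℕ => k * p k) μ)
    (hper : ∃ k₀, ∀ n ≥ k₀, n ∈ AddSubmonoid.closure {k | p k ≠ 0})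
    (hu : ∀ n, 0 ≤ u n)
    (hrec : PowerSeries.mk u = 1 + PowerSeries.mk p * PowerSeries.mk u) :
    Tendsto u atTop (𝓝 μ⁻¹) := by
  set r : ℕ → ℝ := fun j => 1 - ∑ k ∈ Finset.range (j + 1), p k with hrdef
  have hrsum : HasSum r μ := hasSum_tail_of_hasSum_mul hp hsum hmean
  have hr (j : ℕ) : 0 ≤ r j := sub_nonneg.mpr (sum_le_hasSum _ (fun i _ => hp i) hsum)
  have hr0 : r 0 = 1 := by simp [hrdef, hp0]
  have hgeom : PowerSeries.mk (fun _ : ℕ => (1 : ℝ)) * (1 - PowerSeries.X) = 1 :=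
    PowerSeries.mk_one_mul_one_sub_eq_one ℝ
  have hR : PowerSeries.mk r * (1 - PowerSeries.X) = 1 - PowerSeries.mk p := by
    ext n
    rw [mul_sub, mul_one]
    cases n with
    | zero => simp [hr0, hp0]
    | succ n =>
      simp [PowerSeries.coeff_succ_mul_X, hrdef, Finset.sum_range_succ _ (n + 1),
        PowerSeries.coeff_one]
  have hRU : PowerSeries.mk r * PowerSeries.mk u = PowerSeries.mk fun _ : ℕ => (1 : ℝ) := by
    have h : PowerSeries.mk r * PowerSeries.mk u * (1 - PowerSeries.X) = 1 := by
      rw [mul_right_comm, hR, sub_mul, one_mul, sub_eq_iff_eq_add]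
      exact hrec
    calc _ = PowerSeries.mk r * PowerSeries.mk u *
          (PowerSeries.mk (fun _ : ℕ => (1 : ℝ)) * (1 - PowerSeries.X)) := by rw [hgeom, mul_one]
      _ = PowerSeries.mk r * PowerSeries.mk u * (1 - PowerSeries.X) *
          PowerSeries.mk (fun _ : ℕ => (1 : ℝ)) := by ring
      _ = _ := by rw [h, one_mul]
  have hRU' (n : ℕ) : ∑ k ∈ Finset.range (n + 1), r k * u (n - k) = 1 := by
    have := congrArg (PowerSeries.coeff n) hRU
    rw [PowerSeries.coeff_mul, Finset.Nat.sum_antidiagonal_eq_sum_range_succ_mk] at this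
    simpa using this
  have hPU' (n : ℕ) (hn : 1 ≤ n) : ∑ k ∈ Finset.range (n + 1), p k * u (n - k) = u n := by
    have := congrArg (PowerSeries.coeff n) hrec
    rw [map_add, PowerSeries.coeff_mul, Finset.Nat.sum_antidiagonal_eq_sum_range_succ_mk,
      PowerSeries.coeff_one, if_neg (by omega)] at this
    simpa using this.symm
  have hu1 (n : ℕ) : u n ≤ 1 := by
    rw [← hRU' n]
    refine le_trans (le_of_eq ?_) (Finset.single_le_sum
      (fun k _ => mul_nonneg (hr k) (hu (n - k))) (Finset.mem_range.mpr n.succ_pos))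
    simp [hr0]
  -- Extension by zero turns the finite convolutions into full series; the recursion then holds only
  -- from `z = 1`, because of the source term at `0`.
  set x : ℤ → ℝ := fun z => if 0 ≤ z then u z.toNat else 0 with hxdef
  have hx (n : ℕ) : x n = u n := by simp [hxdef]
  have hxabs (z : ℤ) : |x z| ≤ 1 := by
    simp only [hxdef]
    split_ifs
    · rw [abs_of_nonneg (hu _)]
      exact hu1 _
    · simp
  have hconv (q : ℕ → ℝ) (n : ℕ) : HasSum (fun k : ℕ => q k * x (n - k))
      (∑ k ∈ Finset.range (n + 1), q k * u (n - k)) := by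
    have h := hasSum_sum_of_ne_finset_zero (L := .unconditional ℕ)
      (f := fun k : ℕ => q k * x (n - k)) (s := Finset.range (n + 1)) (by
        intro b hb
        simp only [Finset.mem_range, not_lt] at hb
        simp only [hxdef]
        rw [if_neg (by omega), mul_zero])
    convert h using 1
    refine Finset.sum_congr rfl fun k hk => ?_
    rw [← hx, Nat.cast_sub (Nat.lt_succ_iff.mp (Finset.mem_range.mp hk))]
  have hxrec (z : ℤ) (hz : 1 ≤ z) : HasSum (fun k : ℕ => p k * x (z - k)) (x z) := by
    lift z to ℕ using by omega
    rw [hx, ← hPU' z (by omega)]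
    exact hconv p z
  have hxcons (z : ℤ) (hz : 0 ≤ z) : HasSum (fun k : ℕ => r k * x (z - k)) 1 := by
    lift z to ℕ using hz
    rw [← hRU' z]
    exact hconv r z
  have hμ : μ ≠ 0 := by
    have : 1 ≤ μ := hr0 ▸ le_hasSum hrsum 0 fun j _ => hr j
    positivity
  obtain ⟨a, F, hF, hlim, hsup⟩ := exists_ultrafilter_tendsto_limsup hxabs
  have ha := renewal_limit_mul_mean hp hsum hr hrsum hper hxabs hxrec hxcons hF hlim hsup
  obtain ⟨b, G, hG, hlim', hinf⟩ := exists_ultrafilter_tendsto_limsup (x := fun z => -x z)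
    (by simpa using hxabs)
  have hb := renewal_limit_mul_mean (c := -1) hp hsum hr hrsum hper (by simpa using hxabs)
    (fun z hz => by simpa using (hxrec z hz).neg) (fun z hz => by simpa using (hxcons z hz).neg)
    hG hlim' hinf
  have ha' : a = μ⁻¹ := eq_inv_of_mul_eq_one_left ha
  have hb' : b = -μ⁻¹ := by
    rw [← neg_eq_iff_eq_neg]
    exact eq_inv_of_mul_eq_one_left (by linarith)
  have hxlim : Tendsto x atTop (𝓝 μ⁻¹) := by
    rw [Metric.tendsto_nhds]
    intro ε hε
    filter_upwards [hsup ε hε, hinf ε hε] with z h1 h2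
    rw [Real.dist_eq, abs_lt]
    constructor <;> linarith
  exact (hxlim.comp tendsto_natCast_atTop_atTop).congr hx

/-! ### Cesàro limit of a self-convolution -/

/-- The Cesàro means of the self-convolution of a convergent sequence. -/
theorem tendsto_convolution_div {u : ℕ → ℝ} {a : ℝ} (hu : Tendsto u atTop (𝓝 a)) :
    Tendsto (fun n : ℕ => (∑ q ∈ Finset.HasAntidiagonal.antidiagonal n, u q.1 * u q.2) / n) atTop
      (𝓝 (a * a)) := by
  obtain ⟨B, hB⟩ := hu.norm.isBoundedUnder_le.bddAbove_range
  have hB' (n : ℕ) : |u n| ≤ B := hB ⟨n, rfl⟩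
  have hsucc {v : ℕ → ℝ} {b : ℝ} (hv : Tendsto v atTop (𝓝 b)) :
      Tendsto (fun n : ℕ => (∑ k ∈ Finset.range (n + 1), v k) / n) atTop (𝓝 b) := by
    have h := (hv.cesaro.add (hv.mul tendsto_inv_atTop_nhds_zero_nat))
    rw [mul_zero, add_zero] at h
    refine h.congr fun n => ?_
    rw [Finset.sum_range_succ]
    ring
  -- Write `u k * u (n - k) = a * u (n - k) + (u k - a) * u (n - k)`; the second part averages to
  -- zero.
  have herr : Tendsto (fun n : ℕ => (∑ k ∈ Finset.range (n + 1), (u k - a) * u (n - k)) / n)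
      atTop (𝓝 0) := by
    have h0 : Tendsto (fun n => |u n - a| * B) atTop (𝓝 0) := by
      simpa using ((hu.sub_const a).abs.mul_const B)
    refine squeeze_zero_norm (fun n => ?_) (hsucc h0)
    rw [norm_div, Real.norm_natCast]
    gcongr
    refine (norm_sum_le _ _).trans (Finset.sum_le_sum fun k _ => ?_)
    rw [norm_mul]
    exact mul_le_mul_of_nonneg_left (hB' _) (norm_nonneg _)
  have h := ((hsucc hu).const_mul a).add herr
  rw [add_zero] at h
  refine h.congr fun n => ?_
  rw [Finset.Nat.sum_antidiagonal_eq_sum_range_succ_mk, ← Finset.sum_range_reflect u (n + 1),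
    mul_div_assoc', ← add_div, Finset.mul_sum, ← Finset.sum_add_distrib]
  congr 1
  refine Finset.sum_congr rfl fun k _ => ?_
  rw [show n + 1 - 1 - k = n - k by omega]
  ring

/-! ### First-block recursions for compositions -/

/-- The blocks of the allowed compositions of `n`, as a finite set of lists. -/
noncomputable def allowedLists (H : ℕ → ℕ) (m n : ℕ) : Finset (List ℕ) :=
  (allowedCompositions H m n).map ⟨Composition.blocks, fun _ _ h => Composition.ext h⟩

theorem mem_allowedLists {H : ℕ → ℕ} {m n : ℕ} (hpos : ∀ i, m ≤ i → 0 < H i) {l : List ℕ} :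
    l ∈ allowedLists H m n ↔ (∀ b ∈ l, b ∈ H '' Set.Ici m) ∧ l.sum = n := by
  simp only [allowedLists, allowedCompositions, Finset.mem_map, Finset.mem_filter,
    Finset.mem_univ, true_and]
  constructor
  · rintro ⟨c, hc, rfl⟩
    exact ⟨hc, c.blocks_sum⟩
  · rintro ⟨hl, hsum⟩
    refine ⟨⟨l, fun {b} hb => ?_, hsum⟩, hl, rfl⟩
    obtain ⟨i, hi, rfl⟩ := hl b hb
    exact hpos i hi

/-- Splitting off the first block. -/
theorem sum_allowedLists {H : ℕ → ℕ} {m : ℕ} (hpos : ∀ i, m ≤ i → 0 < H i) (f : List ℕ → ℝ)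
    (n : ℕ) :
    ∑ l ∈ allowedLists H m n, f l = (if n = 0 then f [] else 0) +
      ∑ q ∈ Finset.HasAntidiagonal.antidiagonal n, (H '' Set.Ici m).indicator 1 q.1 *
        ∑ l ∈ allowedLists H m q.2, f (q.1 :: l) := by
  classical
  have hmul (q : ℕ × ℕ) : (H '' Set.Ici m).indicator 1 q.1 *
      ∑ l ∈ allowedLists H m q.2, f (q.1 :: l) =
        if q.1 ∈ H '' Set.Ici m then ∑ l ∈ allowedLists H m q.2, f (q.1 :: l) else 0 := by
    by_cases h : q.1 ∈ H '' Set.Ici m <;> simp only [Set.indicator_of_mem, Set.indicator_of_notMem,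
      h, not_false_eq_true, Pi.one_apply, one_mul, zero_mul, if_true, if_false]
  simp only [hmul]
  rw [← Finset.sum_filter, Finset.sum_sigma', ← Finset.sum_filter_add_sum_filter_not _ (· = [])]
  congr 1
  · split_ifs with hn
    · rw [Finset.sum_eq_single []]
      · intro l hl hne
        exact absurd (Finset.mem_filter.mp hl).2 hne
      · intro h
        refine absurd ?_ h
        rw [Finset.mem_filter, mem_allowedLists hpos]
        simp [hn]
    · refine Finset.sum_eq_zero fun l hl => absurd ?_ hn
      obtain ⟨hl, rfl⟩ := Finset.mem_filter.mp hl
      simpa using ((mem_allowedLists hpos).mp hl).2.symm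
  · refine (Finset.sum_bij (fun s _ => s.1.1 :: s.2) ?_ ?_ ?_ ?_).symm
    · rintro ⟨⟨k, j⟩, l⟩ h
      simp only [Finset.mem_sigma, Finset.mem_filter, Finset.HasAntidiagonal.mem_antidiagonal,
        mem_allowedLists hpos] at h ⊢
      refine ⟨⟨?_, ?_⟩, by simp⟩
      · simpa only [List.forall_mem_cons] using ⟨h.1.2, h.2.1⟩
      · rw [List.sum_cons, h.2.2, h.1.1]
    · rintro ⟨⟨k, j⟩, l⟩ h ⟨⟨k', j'⟩, l'⟩ h' heq
      simp only [Finset.mem_sigma, Finset.mem_filter, Finset.HasAntidiagonal.mem_antidiagonal,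
        mem_allowedLists hpos] at h h' heq
      obtain ⟨rfl, rfl⟩ := List.cons.inj heq
      obtain rfl : j = j' := by omega
      rfl
    · intro l hl
      simp only [Finset.mem_filter, mem_allowedLists hpos] at hl
      cases l with
      | nil => exact absurd rfl hl.2
      | cons k l =>
        refine ⟨⟨⟨k, l.sum⟩, l⟩, ?_, rfl⟩
        have h := hl.1.1
        rw [List.forall_mem_cons] at h
        simp only [Finset.mem_sigma, Finset.mem_filter, Finset.HasAntidiagonal.mem_antidiagonal,
          mem_allowedLists hpos]
        refine ⟨⟨?_, h.1⟩, h.2, trivial⟩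
        simpa using hl.1.2
    · intros
      rfl

theorem card_allowedCompositions_eq {H : ℕ → ℕ} {m : ℕ} (hpos : ∀ i, m ≤ i → 0 < H i) (n : ℕ) :
    ((allowedCompositions H m n).card : ℝ) = (if n = 0 then 1 else 0) +
      ∑ q ∈ Finset.HasAntidiagonal.antidiagonal n, (H '' Set.Ici m).indicator 1 q.1 *
        ((allowedCompositions H m q.2).card : ℝ) := by
  simpa [allowedLists] using sum_allowedLists hpos (fun _ => 1) n

theorem sum_length_allowedCompositions_eq {H : ℕ → ℕ} {m : ℕ} (hpos : ∀ i, m ≤ i → 0 < H i)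
    (n : ℕ) :
    ∑ c ∈ allowedCompositions H m n, (c.length : ℝ) =
      ∑ q ∈ Finset.HasAntidiagonal.antidiagonal n, (H '' Set.Ici m).indicator 1 q.1 *
        (∑ c ∈ allowedCompositions H m q.2, (c.length : ℝ) +
          ((allowedCompositions H m q.2).card : ℝ)) := by
  have h := sum_allowedLists hpos (fun l => (l.length : ℝ)) n
  simp only [allowedLists, Finset.sum_map, List.length_cons, List.length_nil, Nat.cast_zero,
    ite_self, zero_add, Nat.cast_add, Nat.cast_one, Finset.sum_add_distrib, Finset.sum_const,
    nsmul_eq_mul, mul_one, Finset.card_map] at h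
  exact h

/-! ### The series `t` and its root -/

theorem summable_pow_comp {h : ℕ → ℕ} (hh : StrictMono h) {x : ℝ} (hx0 : 0 ≤ x) (hx1 : x < 1) :
    Summable fun i => x ^ h i :=
  (summable_geometric_of_lt_one hx0 hx1).comp_injective hh.injective

theorem summable_mul_pow_pred_comp {h : ℕ → ℕ} (hh : StrictMono h) {x : ℝ} (hx0 : 0 < x)
    (hx1 : x < 1) : Summable fun i => (h i : ℝ) * x ^ (h i - 1) := by
  have hs := (summable_pow_mul_geometric_of_norm_lt_one 1
    (by rwa [Real.norm_of_nonneg hx0.le] : ‖x‖ < 1)).mul_right x⁻¹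
  refine (hs.comp_injective hh.injective).congr fun i => ?_
  rcases Nat.eq_zero_or_pos (h i) with h0 | h0
  · simp [h0]
  · obtain ⟨k, hk⟩ := Nat.exists_eq_add_of_le' h0
    simp only [Function.comp_apply, hk, pow_one, Nat.add_sub_cancel]
    field_simp
    exact pow_succ' x k

theorem hasDerivAt_tsum_pow_comp {h : ℕ → ℕ} (hh : StrictMono h) {x : ℝ} (hx0 : 0 < x)
    (hx1 : x < 1) :
    HasDerivAt (fun y : ℝ => ∑' i, y ^ h i) (∑' i, (h i : ℝ) * x ^ (h i - 1)) x := by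
  -- On `(0, b)` the derivative terms are dominated by their values at `b < 1`.
  obtain ⟨b, hxb, hb1⟩ := exists_between hx1
  refine hasDerivAt_tsum_of_isPreconnected (t := Set.Ioo 0 b)
    (summable_mul_pow_pred_comp hh (hx0.trans hxb) hb1) isOpen_Ioo isPreconnected_Ioo
    (fun i y _ => hasDerivAt_pow (h i) y) (fun i y hy => ?_) (y₀ := x) ⟨hx0, hxb⟩
    (summable_pow_comp hh hx0.le hx1) ⟨hx0, hxb⟩
  rw [norm_mul, norm_pow, Real.norm_natCast, Real.norm_of_nonneg hy.1.le]
  have := hy.1.le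
  have := hy.2.le
  gcongr

/-- The first two terms tend to `2` as `x → 1`, so the series exceeds `1` at some `b < 1`; the
intermediate value theorem applies on `[0, b]`. -/
theorem exists_tsum_pow_comp_eq_one {h : ℕ → ℕ} (hh : StrictMono h) (hpos : 0 < h 0) :
    ∃ γ ∈ Set.Ioo (0 : ℝ) 1, HasSum (fun i => γ ^ h i) 1 := by
  have hposi (i : ℕ) : 0 < h i := hpos.trans_le (hh.monotone i.zero_le)
  obtain ⟨b, hb, hb0, hb1⟩ : ∃ b : ℝ, 1 < b ^ h 0 + b ^ h 1 ∧ 0 < b ∧ b < 1 := by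
    have hc : Tendsto (fun b : ℝ => b ^ h 0 + b ^ h 1) (𝓝[<] 1) (𝓝 (1 ^ h 0 + 1 ^ h 1)) :=
      (Continuous.tendsto (by fun_prop) 1).mono_left nhdsWithin_le_nhds
    have h1 := hc.eventually (lt_mem_nhds (a := 1) (by norm_num))
    have h2 : ∀ᶠ b : ℝ in 𝓝[<] 1, b ∈ Set.Ioo 0 1 := Ioo_mem_nhdsLT one_pos
    obtain ⟨b, h1, h2⟩ := (h1.and h2).exists
    exact ⟨b, h1, h2.1, h2.2⟩
  have hcont : ContinuousOn (fun x : ℝ => ∑' i, x ^ h i) (Set.Icc 0 b) := by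
    refine continuousOn_tsum (fun i => by fun_prop) (summable_pow_comp hh hb0.le hb1)
      fun i x hx => ?_
    rw [norm_pow, Real.norm_of_nonneg hx.1]
    exact pow_le_pow_left₀ hx.1 hx.2 _
  have hzero : ∑' i, (0 : ℝ) ^ h i = 0 := by simp [zero_pow (hposi _).ne']
  have hbig : 1 < ∑' i, b ^ h i := by
    refine hb.trans_le ?_
    have := (summable_pow_comp hh hb0.le hb1).sum_le_tsum (Finset.range 2)
      fun i _ => pow_nonneg hb0.le _
    simpa [Finset.sum_range_succ] using this
  obtain ⟨γ, hγ, hγ1⟩ := intermediate_value_Icc hb0.le hcont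
    (show (1 : ℝ) ∈ Set.Icc _ _ from ⟨by simp only [hzero]; exact zero_le_one, hbig.le⟩)
  have hlt : γ < 1 := hγ.2.trans_lt hb1
  refine ⟨γ, ⟨lt_of_le_of_ne hγ.1 ?_, hlt⟩, ?_⟩
  · rintro rfl
    simp only [hzero] at hγ1
    exact zero_ne_one hγ1
  · rw [← hγ1]
    exact (summable_pow_comp hh hγ.1 hlt).hasSum

theorem hasSum_pow_comp_one_iff {h : ℕ → ℕ} (hpos : ∀ i, 0 < h i) {γ x : ℝ}
    (hγ0 : 0 < γ) (hγ : HasSum (fun i => γ ^ h i) 1) (hx : 0 < x) :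
    HasSum (fun i => x ^ h i) 1 ↔ x = γ := by
  have hlt {y z : ℝ} (hy0 : 0 < y) (hyz : y < z) (hy : HasSum (fun i => y ^ h i) 1)
      (hz : HasSum (fun i => z ^ h i) 1) : False :=
    lt_irrefl _ (hasSum_lt (i := 0) (fun i => pow_le_pow_left₀ hy0.le hyz.le _)
      (pow_lt_pow_left₀ hyz hy0.le (hpos 0).ne') hy hz)
  constructor
  · intro h
    rcases lt_trichotomy x γ with hlt' | rfl | hlt'
    · exact (hlt hx hlt' h hγ).elim
    · rfl
    · exact (hlt hγ0 hlt' hγ h).elim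
  · rintro rfl
    exact hγ

/-! ### Generating functions -/

/-- Scaling the coefficients of a Cauchy product by a geometric sequence. -/
theorem sum_antidiagonal_mul_pow (a b : ℕ → ℝ) (x : ℝ) (n : ℕ) :
    (∑ q ∈ Finset.HasAntidiagonal.antidiagonal n, a q.1 * b q.2) * x ^ n =
      PowerSeries.coeff n
        (PowerSeries.mk (fun k => a k * x ^ k) * PowerSeries.mk fun k => b k * x ^ k) := by
  rw [PowerSeries.coeff_mul, Finset.sum_mul]
  refine Finset.sum_congr rfl fun q hq => ?_
  rw [← Finset.HasAntidiagonal.mem_antidiagonal.mp hq, pow_add, PowerSeries.coeff_mk,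
    PowerSeries.coeff_mk]
  ring

theorem mk_card_allowedCompositions {H : ℕ → ℕ} {m : ℕ} (hpos : ∀ i, m ≤ i → 0 < H i) (x : ℝ) :
    PowerSeries.mk (fun n => ((allowedCompositions H m n).card : ℝ) * x ^ n) =
      1 + PowerSeries.mk (fun k => (H '' Set.Ici m).indicator 1 k * x ^ k) *
        PowerSeries.mk fun n => ((allowedCompositions H m n).card : ℝ) * x ^ n := by
  ext n
  rw [PowerSeries.coeff_mk, card_allowedCompositions_eq hpos n, add_mul, map_add,
    PowerSeries.coeff_one,
    sum_antidiagonal_mul_pow ((H '' Set.Ici m).indicator 1)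
      (fun n => ((allowedCompositions H m n).card : ℝ))]
  congr 1
  split_ifs with hn <;> simp [hn]

/-- Removing the first block lowers the length by one, so `V = P (V + U)`; eliminating `P` with `U =
1 + P U` leaves `V = U² - U`. -/
theorem mk_sum_length_allowedCompositions {H : ℕ → ℕ} {m : ℕ} (hpos : ∀ i, m ≤ i → 0 < H i)
    (x : ℝ) :
    PowerSeries.mk (fun n => (∑ c ∈ allowedCompositions H m n, (c.length : ℝ)) * x ^ n) =
      PowerSeries.mk (fun n => ((allowedCompositions H m n).card : ℝ) * x ^ n) *
        PowerSeries.mk (fun n => ((allowedCompositions H m n).card : ℝ) * x ^ n) -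
      PowerSeries.mk (fun n => ((allowedCompositions H m n).card : ℝ) * x ^ n) := by
  have hU := mk_card_allowedCompositions hpos x
  set U := PowerSeries.mk (fun n => ((allowedCompositions H m n).card : ℝ) * x ^ n) with hUdef
  set V := PowerSeries.mk (fun n => (∑ c ∈ allowedCompositions H m n, (c.length : ℝ)) * x ^ n)
    with hVdef
  set P := PowerSeries.mk (fun k => (H '' Set.Ici m).indicator (1 : ℕ → ℝ) k * x ^ k) with hPdef
  have hV : V = P * (V + U) := by
    have hVU : V + U = PowerSeries.mk fun n => (∑ c ∈ allowedCompositions H m n, (c.length : ℝ) +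
        ((allowedCompositions H m n).card : ℝ)) * x ^ n := by
      ext n
      simp [hUdef, hVdef, add_mul]
    ext n
    rw [hVU, hPdef, ← sum_antidiagonal_mul_pow ((H '' Set.Ici m).indicator 1),
      ← sum_length_allowedCompositions_eq hpos, hVdef, PowerSeries.coeff_mk]
  linear_combination U * hV - (U + V) * hU

/-! ### Assembly of the asymptotics -/

theorem theorem3p3 (H : ℕ → ℕ) (m : ℕ)
    (hmono : StrictMonoOn H (Set.Ici m))
    (hpos : ∀ i, m ≤ i → 0 < H i)
    (hgcd : ∀ d : ℕ, (∀ i, m ≤ i → d ∣ H i) → d = 1) :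
    ∃ γ ∈ Set.Ioo (0 : ℝ) 1,
      (∀ x : ℝ, 0 < x → (HasSum (fun i : ℕ => x ^ H (m + i)) 1 ↔ x = γ)) ∧
      DifferentiableAt ℝ (partSeries H m) γ ∧
      0 < deriv (partSeries H m) γ ∧
      (fun n : ℕ => ((allowedCompositions H m n).card : ℝ)) ~[atTop]
        (fun n : ℕ => 1 / deriv (partSeries H m) γ * γ ^ (-(n : ℤ) - 1)) ∧
      (fun n : ℕ => meanSummands H m n) ~[atTop]
        (fun n : ℕ => 1 / (γ * deriv (partSeries H m) γ) * (n : ℝ)) := by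
  have hh : StrictMono fun i => H (m + i) := fun i j hij =>
    hmono (Set.mem_Ici.mpr (by omega)) (Set.mem_Ici.mpr (by omega)) (by omega)
  have hposi (i : ℕ) : 0 < H (m + i) := hpos _ (by omega)
  obtain ⟨γ, ⟨hγ0, hγ1⟩, hγ⟩ := exists_tsum_pow_comp_eq_one hh (hposi 0)
  have hderiv : HasDerivAt (partSeries H m) _ γ := hasDerivAt_tsum_pow_comp hh hγ0 hγ1
  have hDs := summable_mul_pow_pred_comp hh hγ0 hγ1
  have hDpos : 0 < ∑' i, (H (m + i) : ℝ) * γ ^ (H (m + i) - 1) :=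
    hDs.tsum_pos (fun i => by positivity) 0
      (mul_pos (Nat.cast_pos.mpr (hposi 0)) (pow_pos hγ0 _))
  refine ⟨γ, ⟨hγ0, hγ1⟩, fun x hx => hasSum_pow_comp_one_iff hposi hγ0 hγ hx,
    hderiv.differentiableAt, ?_⟩
  rw [hderiv.deriv]
  generalize hD : ∑' i, (H (m + i) : ℝ) * γ ^ (H (m + i) - 1) = D at hDpos
  refine ⟨hDpos, ?_⟩
  have hrange : Set.range (fun i => H (m + i)) = H '' Set.Ici m := by
    ext k
    constructor
    · rintro ⟨i, rfl⟩
      exact ⟨m + i, Set.mem_Ici.mpr (by omega), rfl⟩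
    · rintro ⟨i, hi, rfl⟩
      exact ⟨i - m, by simp only [Nat.add_sub_cancel' (Set.mem_Ici.mp hi)]⟩
  have hmem (i : ℕ) : H (m + i) ∈ H '' Set.Ici m := hrange ▸ Set.mem_range_self i
  set p : ℕ → ℝ := fun k => (H '' Set.Ici m).indicator 1 k * γ ^ k with hpdef
  have hpH (i : ℕ) : p (H (m + i)) = γ ^ H (m + i) := by
    simp only [hpdef, Set.indicator_of_mem (hmem i), Pi.one_apply, one_mul]
  have hpout (k : ℕ) (hk : k ∉ H '' Set.Ici m) : p k = 0 := by
    simp only [hpdef, Set.indicator_of_notMem hk, zero_mul]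
  have hp (k : ℕ) : 0 ≤ p k :=
    mul_nonneg (Set.indicator_nonneg (fun _ _ => zero_le_one) k) (pow_nonneg hγ0.le k)
  have hp0 : p 0 = 0 := hpout 0 fun ⟨i, hi, hi0⟩ => (hpos i hi).ne' hi0
  have hsum : HasSum p 1 := by
    rw [← hh.injective.hasSum_iff (by rw [hrange]; exact hpout)]
    simpa only [Function.comp_def, hpH] using hγ
  have hmean : HasSum (fun k : ℕ => k * p k) (γ * D) := by
    rw [← hh.injective.hasSum_iff (by
      rw [hrange]
      intro k hk
      rw [hpout k hk, mul_zero])]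
    have he : (fun k : ℕ => k * p k) ∘ (fun i => H (m + i)) =
        fun i => γ * ((H (m + i) : ℝ) * γ ^ (H (m + i) - 1)) := by
      funext i
      simp only [Function.comp_apply, hpH]
      obtain ⟨k, hk⟩ := Nat.exists_eq_add_of_le' (hposi i)
      rw [hk, Nat.add_sub_cancel]
      ring
    rw [he, ← hD]
    exact hDs.hasSum.mul_left γ
  have hsupp : {k | p k ≠ 0} = H '' Set.Ici m := by
    ext k
    refine ⟨fun hk => by_contra fun hk' => hk (hpout k hk'), fun hk => ?_⟩
    obtain ⟨i, rfl⟩ := hrange ▸ hk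
    exact (hpH i).trans_ne (pow_pos hγ0 _).ne'
  -- A set of naturals with gcd 1 generates every sufficiently large integer.
  have hper : ∃ k₀, ∀ n ≥ k₀, n ∈ AddSubmonoid.closure {k | p k ≠ 0} := by
    rw [hsupp]
    obtain ⟨k₀, hk₀⟩ := Nat.exists_mem_closure_of_ge (s := H '' Set.Ici m)
    have h1 : Nat.setGcd (H '' Set.Ici m) = 1 :=
      hgcd _ fun i hi => Nat.setGcd_dvd_of_mem ⟨i, hi, rfl⟩
    exact ⟨k₀, fun n hn => hk₀ n hn (h1 ▸ one_dvd n)⟩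
  set u : ℕ → ℝ := fun n => ((allowedCompositions H m n).card : ℝ) * γ ^ n with hudef
  have hu : Tendsto u atTop (𝓝 (γ * D)⁻¹) :=
    tendsto_renewal hp hp0 hsum hmean hper (fun n => by positivity)
      (mk_card_allowedCompositions hpos γ)
  have hμ : 0 < γ * D := mul_pos hγ0 hDpos
  have huEquiv : u ~[atTop] fun _ => (γ * D)⁻¹ :=
    (isEquivalent_const_iff_tendsto (inv_pos.mpr hμ).ne').mpr hu
  have hlen (n : ℕ) : (∑ c ∈ allowedCompositions H m n, (c.length : ℝ)) * γ ^ n =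
      ∑ q ∈ Finset.HasAntidiagonal.antidiagonal n, u q.1 * u q.2 - u n := by
    have := congrArg (PowerSeries.coeff n) (mk_sum_length_allowedCompositions hpos γ)
    simpa [PowerSeries.coeff_mul] using this
  have hv : Tendsto (fun n : ℕ => (∑ c ∈ allowedCompositions H m n, (c.length : ℝ)) * γ ^ n / n)
      atTop (𝓝 ((γ * D)⁻¹ * (γ * D)⁻¹)) := by
    have h := (tendsto_convolution_div hu).sub (hu.mul tendsto_inv_atTop_nhds_zero_nat)
    rw [mul_zero, sub_zero] at h
    refine h.congr fun n => ?_
    rw [hlen, sub_div, div_eq_mul_inv (u n)]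
  have hvEquiv := (isEquivalent_const_iff_tendsto
    (mul_pos (inv_pos.mpr hμ) (inv_pos.mpr hμ)).ne').mpr hv
  constructor
  · have h := huEquiv.mul (IsEquivalent.refl (u := fun n : ℕ => (γ ^ n)⁻¹))
    refine (h.congr_left (Eventually.of_forall fun n => ?_)).congr_right
      (Eventually.of_forall fun n => ?_)
    · simp only [Pi.mul_apply, hudef]
      field_simp
    · simp only [Pi.mul_apply]
      rw [zpow_sub₀ hγ0.ne', zpow_neg, zpow_natCast, zpow_one]
      field_simp
  -- The mean is the weighted total length over `u n`; the factors `γ ^ n` cancel.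
  · have h := (hvEquiv.mul (IsEquivalent.refl (u := fun n : ℕ => (n : ℝ)))).div huEquiv
    refine (h.congr_left ?_).congr_right (Eventually.of_forall fun n => ?_)
    · filter_upwards [eventually_ne_atTop 0] with n hn
      have hn' : (n : ℝ) ≠ 0 := Nat.cast_ne_zero.mpr hn
      simp only [Pi.mul_apply, Pi.div_apply, hudef, meanSummands]
      rw [div_mul_cancel₀ _ hn', mul_div_mul_right _ _ (pow_pos hγ0 n).ne']
    · simp only [Pi.mul_apply, Pi.div_apply, Function.const_apply]
      field_simp
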